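/- Let $\mathbb{B}$ be a Boolean algebra and let $n,k$ be integers with $n \ge k \ge 2$. An *$n$-partition* of $\mathbb{B}$ is a set $R\subseteq\mathbb{B}$ of exactly $n$ elements such that $\bigvee R = 1$ and $a\wedge b = 0$ for all distinct $a,b\in R$. A set $A\subseteq\mathbb{B}$ is *$(n,k)$-reaped* by $R$ if $R$ is an $n$-partition of $\mathbb{B}$ and $|\{b\in R : b\wedge a\neq 0\}|\ge k$ for every $a\in A$. The *reaping number* $\mathfrak{r}_{n,k}(\mathbb{B})$ is the least cardinality of a set $A\subseteq\mathbb{B}\setminus\{0\}$ which is not $(n,k)$-reaped by any $n$-partition of $\mathbb{B}$. There are Boolean algebras $\mathbb{B}_1$, $\mathbb{B}_2$ and $\mathbb{B}_3$ such that - $\mathfrak{r}_{9,5}(\mathbb{B}_1)\not\leq\mathfrak{r}_{2,2}(\mathbb{B}_1)$, - $\mathfrak{r}_{10,4}(\mathbb{B}_2)\not\leq\mathfrak{r}_{3,2}(\mathbb{B}_2)$, - $\mathfrak{r}_{9,3}(\mathbb{B}_3)\not\leq\mathfrak{r}_{4,2}(\mathbb{B}_3)$. -/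

import Mathlib

universe u

namespace BooleanReaping

variable {B : Type u} [BooleanAlgebra B]

/-- An `n`-partition of `B`: a set of exactly `n` pairwise disjoint elements with join `1`. -/
def IsPartition (n : ℕ) (R : Finset B) : Prop :=
  R.card = n ∧ R.sup id = ⊤ ∧ (R : Set B).PairwiseDisjoint id

/-- `A` is `(n, k)`-reaped by `R`: `R` is an `n`-partition of `B` and every `a ∈ A` meets at
least `k` members of `R`. -/
def IsReapedBy (n k : ℕ) (A : Set B) (R : Finset B) : Prop :=
  IsPartition n R ∧ ∀ a ∈ A, k ≤ Set.ncard {b : B | b ∈ R ∧ b ⊓ a ≠ ⊥}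

variable (B) in
/-- The reaping number `r_{n,k}(B)`: the least cardinality of a subset of `B \ {0}` which is not
`(n, k)`-reaped by any `n`-partition of `B`. For `k ≥ 2` such subsets exist,
see `exists_not_reaped`. -/
noncomputable def reapingNumber (n k : ℕ) : Cardinal.{u} :=
  sInf {κ : Cardinal.{u} | ∃ A : Set B,
    ⊥ ∉ A ∧ (¬ ∃ R : Finset B, IsReapedBy n k A R) ∧ Cardinal.mk A = κ}

variable (B) in
/-- If `n, k ≥ 2`, the set of all nonzero elements is not `(n, k)`-reaped by any partition, so the
infimum defining `reapingNumber` is attained. -/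
theorem exists_not_reaped {n k : ℕ} (hn : 2 ≤ n) (hk : 2 ≤ k) :
    ∃ A : Set B, ⊥ ∉ A ∧ ¬ ∃ R : Finset B, IsReapedBy n k A R := by
  refine ⟨{a | a ≠ ⊥}, by simp, ?_⟩
  rintro ⟨R, ⟨hc, -, hd⟩, hR⟩
  obtain ⟨c, hcR, hc0⟩ : ∃ c ∈ R, c ≠ ⊥ :=
    Finset.exists_mem_ne (by omega) ⊥
  have hsub : {b : B | b ∈ R ∧ b ⊓ c ≠ ⊥} ⊆ {c} := by
    rintro b ⟨hb, hbc⟩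
    by_contra hne
    exact hbc (hd hb hcR hne).eq_bot
  have h1 := Set.ncard_le_ncard hsub (Set.finite_singleton c)
  rw [Set.ncard_singleton] at h1
  have h2 := hR c hc0
  omega

end BooleanReaping

namespace BooleanReaping

open Filter

/-! Whenever `m * (k - 1) < n`, some algebra satisfies `r_{m,2} ≤ ℵ₀ < r_{n,k}`; the three claims
are the cases 2·4 < 9, 3·3 < 10 and 4·2 < 9. Its elements are the finitely supported sets of pairs
(rule, branch), where a branch is an `n`-valued function on `ω₁` obeying a rule that leaves at least
`k` choices at each coordinate. Rules read finite data, so there are countably many; yet codes by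
reals and enumerations of predecessors let them treat any finitely many coordinates individually.
The supports of a countable family lie below some `α`, so each nonzero member meets at least `k` of
the `n` cells given by the value at `α` (`exists_reaping_of_countable`). An `m`-partition is, off
finitely many rules, a colouring of branches with finite support. By pigeonhole some rule makes it
constant (`eventually_exists_monochromatic`), and the cell of that rule meets only one piece
(`ruleCells_not_reaped`). -/

/-- A well order of type `ω₁`, with an injective coding of its elements by reals and an
enumeration of each of its proper initial segments. -/
theorem exists_coded_wellOrder :
    ∃ (W : Type) (_ : LinearOrder W) (_ : WellFoundedLT W) (code : W → ℕ → Bool) (h : W → ℕ → W),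
      Function.Injective code ∧ (∀ α β, β < α → ∃ j, h α j = β) ∧
      ∀ s : Set W, s.Countable → ∃ α, ∀ β ∈ s, β < α := by
  let W : Type := (Cardinal.aleph 1).ord.ToType
  have hW : Cardinal.mk W = Cardinal.aleph 1 := Cardinal.mk_ord_toType _
  have hIio : ∀ α : W, (Set.Iio α).Countable := by
    intro α
    have h1 : Cardinal.mk (Set.Iio α) < Cardinal.mk W :=
      Cardinal.mk_Iio_lt α (by rw [hW]; exact (Ordinal.type_toType _).symm)
    exact Cardinal.le_aleph0_iff_set_countable.1
      (Order.lt_succ_iff.1 (h1.trans_eq (hW.trans Cardinal.succ_aleph0.symm)))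
  have hcode : Nonempty (W ↪ (ℕ → Bool)) := by
    rw [← Cardinal.le_def, hW]
    simpa using Cardinal.aleph_one_le_continuum
  obtain ⟨code⟩ := hcode
  have henum : ∀ α : W, ∃ f : ℕ → W, Set.Iio α ⊆ Set.range f := by
    intro α
    have : Nonempty W := ⟨α⟩
    exact Set.countable_iff_exists_subset_range.1 (hIio α)
  choose h hh using henum
  refine ⟨W, inferInstance, inferInstance, code, h, code.injective, fun α β hβ => hh α hβ, ?_⟩
  intro s hs
  by_contra! hcon
  -- If `s` were cofinal, countably many countable initial segments would cover the uncountable `W`.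
  have hcover : (Set.univ : Set W) ⊆ ⋃ β ∈ s, Set.Iic β := by
    intro α _
    obtain ⟨β, hβ, hle⟩ := hcon α
    exact Set.mem_biUnion hβ hle
  have hcount : (Set.univ : Set W).Countable := by
    refine (hs.biUnion fun β _ => ?_).mono hcover
    rw [← Set.Iio_insert]
    exact (hIio β).insert β
  have h2 := Cardinal.le_aleph0_iff_set_countable.2 hcount
  rw [Cardinal.mk_univ, hW] at h2
  exact absurd Cardinal.aleph0_lt_aleph_one h2.not_gt

/-! ### Rules and their branches -/

/-- A rule of level `l` selects a set of at least `k` colours from the first `l` bits of the code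
of a coordinate and the values at the first `l` coordinates enumerated below it. -/
abbrev LevelRule (n k l : ℕ) : Type :=
  (Fin l → Bool) → (Fin l → Fin n) → {s : Finset (Fin n) // k ≤ s.card}

/-- Rules of arbitrary level. -/
abbrev Rule (n k : ℕ) : Type := Σ l, LevelRule n k l

section Construction

variable {W : Type} [LinearOrder W] {n k : ℕ} [NeZero n]
  (code : W → ℕ → Bool) (h : W → ℕ → W)

/-- The values of `x` at the first `l` coordinates enumerated below `α`. -/
def past (α : W) (x : W → Fin n) (l : ℕ) : Fin l → Fin n :=
  fun j => if h α j < α then x (h α j) else 0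

/-- The colours that the rule `a` allows at the coordinate `α`, given the values of `x` below. -/
def allowed (a : Rule n k) (x : W → Fin n) (α : W) : Finset (Fin n) :=
  (a.2 (fun j => code α j) (past h α x a.1)).1

/-- The functions that obey the rule `a` at every coordinate. -/
def branches (a : Rule n k) : Set (W → Fin n) :=
  {x | ∀ α, x α ∈ allowed code h a x α}

variable {h} in
theorem past_congr {α : W} {x y : W → Fin n} (hxy : ∀ β < α, x β = y β) (l : ℕ) :
    past h α x l = past h α y l := by
  funext j
  unfold past
  split_ifs with hj
  · exact hxy _ hj
  · rfl

variable {code h} in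
theorem allowed_congr {α : W} {x y : W → Fin n} (hxy : ∀ β < α, x β = y β) (a : Rule n k) :
    allowed code h a x α = allowed code h a y α := by
  unfold allowed
  rw [past_congr hxy]

theorem exists_branch_extending [WellFoundedLT W] (hk : 0 < k) (a : Rule n k) (y : W → Fin n)
    (D : Set W) (hD : ∀ β ∈ D, ∀ γ < β, γ ∈ D) (hy : ∀ β ∈ D, y β ∈ allowed code h a y β) :
    ∃ x ∈ branches code h a, ∀ β ∈ D, x β = y β := by
  classical
  have hne : ∀ s : {s : Finset (Fin n) // k ≤ s.card}, ∃ i, i ∈ s.1 :=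
    fun s => Finset.card_pos.1 (hk.trans_le s.2)
  choose pick hpick using hne
  let step : ∀ β : W, (∀ γ : W, γ < β → Fin n) → Fin n := fun β ih =>
    if β ∈ D then y β else
      -- The default `0` matches that of `past`, so the recursion equation holds in terms of `past`
      -- by definition.
      pick (a.2 (fun j => code β j) (fun j => if hj : h β j < β then ih _ hj else 0))
  let x : W → Fin n := (wellFounded_lt (α := W)).fix step
  have hx : ∀ β, x β = if β ∈ D then y β else
      pick (a.2 (fun j => code β j) (past h β x a.1)) := by
    intro β
    exact (wellFounded_lt (α := W)).fix_eq step β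
  have hxD : ∀ β ∈ D, x β = y β := fun β hβ => by rw [hx, if_pos hβ]
  refine ⟨x, fun β => ?_, hxD⟩
  by_cases hβ : β ∈ D
  · rw [hxD β hβ, allowed_congr (y := y) fun γ hγ => hxD γ (hD β hβ γ hγ)]
    exact hy β hβ
  · rw [hx β, if_neg hβ]
    exact hpick _

theorem branches_nonempty [WellFoundedLT W] (hk : 0 < k) (a : Rule n k) :
    (branches code h a).Nonempty := by
  obtain ⟨x, hx, -⟩ := exists_branch_extending code h hk a (fun _ => 0) ∅ (by simp) (by simp)
  exact ⟨x, hx⟩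

variable {code h} in
/-- The value of a branch at `α` can be changed to any allowed one without changing the values
below `α`. -/
theorem exists_branch_update [WellFoundedLT W] (hk : 0 < k) {a : Rule n k} {x : W → Fin n}
    (hx : x ∈ branches code h a) {α : W} {i : Fin n} (hi : i ∈ allowed code h a x α) :
    ∃ y ∈ branches code h a, (∀ β < α, y β = x β) ∧ y α = i := by
  have hlt : ∀ β ≤ α, ∀ γ < β, Function.update x α i γ = x γ := fun β hβ γ hγ =>
    Function.update_of_ne (hγ.trans_le hβ).ne _ _
  obtain ⟨y, hy, hyD⟩ := exists_branch_extending code h hk a (Function.update x α i) (Set.Iic α)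
    (fun β hβ γ hγ => hγ.le.trans hβ) (by
      intro β hβ
      rw [allowed_congr (hlt β hβ)]
      rcases eq_or_lt_of_le (show β ≤ α from hβ) with rfl | hβα
      · simpa using hi
      · rw [Function.update_of_ne hβα.ne]
        exact hx β)
  refine ⟨y, hy, fun β hβ => ?_, ?_⟩
  · rw [hyD β hβ.le, hlt α le_rfl β hβ]
  · rw [hyD α le_rfl, Function.update_self]

/-! ### Monochromatic rules by pigeonhole -/

/-- This lets a rule at `α` use the earlier values on which a colouring depends, although it sees
only `past`. -/
theorem exists_recover_past (α : W) (s : Finset W) (hs : ∀ β ∈ s, β < α) (l : ℕ)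
    (hl : ∀ β ∈ s, ∃ j : Fin l, h α j = β) :
    ∃ ρ : (Fin l → Fin n) → W → Fin n, ∀ x, ∀ β ∈ s, ρ (past h α x l) β = x β := by
  classical
  refine ⟨fun d β => if H : ∃ j : Fin l, h α j = β then d H.choose else 0, fun x β hβ => ?_⟩
  have H := hl β hβ
  have hc := H.choose_spec
  show (if H : ∃ j : Fin l, h α j = β then past h α x l H.choose else 0) = x β
  rw [dif_pos H, past, if_pos (hc.symm ▸ hs β hβ), hc]

variable {code h} in
/-- Every colouring that depends on finitely many coordinates is constant on the branches of a
suitable rule of any sufficiently high level. -/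
theorem eventually_exists_monochromatic (hcode : Function.Injective code)
    (hh : ∀ α β, β < α → ∃ j, h α j = β) {C : Type} [Fintype C]
    (hC : Fintype.card C * (k - 1) < n) (hkn : k ≤ n) (F : Finset W) :
    ∀ᶠ l in atTop, ∀ g : (W → Fin n) → C, (∀ x y, (∀ β ∈ F, x β = y β) → g x = g y) →
      ∃ (S : LevelRule n k l) (c : C), ∀ S' : LevelRule n k l,
        (∀ β ∈ F, S' (fun j => code β j) = S (fun j => code β j)) →
        ∀ x ∈ branches code h ⟨l, S'⟩, g x = c := by
  classical
  -- Allowing every `S'` that agrees with `S` at the codes of `F` leaves room to alter the rule at a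
  -- new maximum.
  induction F using Finset.induction_on_max with
  | empty =>
    refine Eventually.of_forall fun l g hg => ?_
    exact ⟨fun _ _ => ⟨Finset.univ, by simpa using hkn⟩, g fun _ => 0,
      fun S' _ x _ => hg _ _ (by simp)⟩
  | insert α s hs ih =>
    have hsep : ∀ᶠ l in atTop, ∀ β ∈ s,
        (∃ j : Fin l, h α j = β) ∧ (fun j : Fin l => code α j) ≠ fun j : Fin l => code β j := by
      refine (Finset.eventually_all s).2 fun β hβ => ?_
      obtain ⟨j, hj⟩ := hh α β (hs β hβ)
      obtain ⟨i, hi⟩ := Function.ne_iff.1 (hcode.ne (hs β hβ).ne')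
      filter_upwards [eventually_gt_atTop j, eventually_gt_atTop i] with l hjl hil
      exact ⟨⟨⟨j, hjl⟩, hj⟩, fun heq => hi (congrFun heq ⟨i, hil⟩)⟩
    filter_upwards [ih, hsep] with l hl hsepl g hg
    have hmaj : ∀ v : Fin n → C, ∃ c, k ≤ (Finset.univ.filter fun i => v i = c).card := by
      intro v
      obtain ⟨c, hc⟩ := Fintype.exists_lt_card_fiber_of_mul_lt_card (n := k - 1) v (by simpa using hC)
      exact ⟨c, by omega⟩
    choose maj hmaj using hmaj
    have hupd : ∀ x y : W → Fin n, (∀ β ∈ s, x β = y β) →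
        (fun i => g (Function.update x α i)) = fun i => g (Function.update y α i) := by
      intro x y hxy
      funext i
      refine hg _ _ fun β hβ => ?_
      rcases Finset.mem_insert.1 hβ with rfl | hβ
      · simp
      · rw [Function.update_of_ne (hs β hβ).ne, Function.update_of_ne (hs β hβ).ne, hxy β hβ]
    -- The majority colour over the values at `α` depends only on `s`, so the induction hypothesis
    -- makes it constant.
    obtain ⟨S, c, hS⟩ := hl (fun x => maj fun i => g (Function.update x α i))
      (fun x y hxy => congrArg maj (hupd x y hxy))
    obtain ⟨ρ, hρ⟩ := exists_recover_past (n := n) h α s hs l fun β hβ => (hsepl β hβ).1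
    -- At `α` exactly the values giving the majority colour are allowed. The code prefix of `α`
    -- differs from those of `s`, so the rule there is unchanged.
    refine ⟨Function.update S (fun j => code α j) fun d => ⟨_, hmaj fun i =>
      g (Function.update (ρ d) α i)⟩, c, fun S' hS' x hx => ?_⟩
    have hfx := hS S' (fun β hβ => by
      rw [hS' β (Finset.mem_insert_of_mem hβ), Function.update_of_ne (hsepl β hβ).2.symm]) x hx
    have hxα : x α ∈ (S' (fun j => code α j) (past h α x l)).1 := hx α
    rw [hS' α (Finset.mem_insert_self α s), Function.update_self] at hxα
    have hval := (Finset.mem_filter.1 hxα).2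
    rw [hupd _ x (hρ x)] at hval
    rw [← hfx, ← hval]
    have := congrFun (hupd _ x (hρ x)) (x α)
    rw [Function.update_eq_self] at this
    exact this.symm

/-! ### The algebra of finitely supported sets -/

/-- The pairs of a rule and one of its branches. -/
abbrev BranchSpace (n k : ℕ) [NeZero n] (code : W → ℕ → Bool) (h : W → ℕ → W) : Type :=
  {p : Rule n k × (W → Fin n) // p.2 ∈ branches code h p.1}

/-- Membership in `s` depends only on the values of the branch on `F` and on which member of `E`
the rule is, if any. -/
def Supports (E : Finset (Rule n k)) (F : Finset W) (s : Set (BranchSpace n k code h)) : Prop :=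
  ∀ p q : BranchSpace n k code h, (∀ a ∈ E, p.1.1 = a ↔ q.1.1 = a) →
    (∀ β ∈ F, p.1.2 β = q.1.2 β) → (p ∈ s ↔ q ∈ s)

variable {code h} in
theorem Supports.mono {E E' : Finset (Rule n k)} {F F' : Finset W}
    {s : Set (BranchSpace n k code h)} (hs : Supports code h E F s) (hE : E ⊆ E') (hF : F ⊆ F') :
    Supports code h E' F' s :=
  fun p q hpE hpF => hs p q (fun a ha => hpE a (hE ha)) fun β hβ => hpF β (hF hβ)

/-- The Boolean algebra of the sets of branches with a finite support. -/
def finSupported (n k : ℕ) [NeZero n] : BooleanSubalgebra (Set (BranchSpace n k code h)) where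
  carrier := {s | ∃ E F, Supports code h E F s}
  supClosed' := by
    classical
    rintro s ⟨E, F, hs⟩ t ⟨E', F', ht⟩
    refine ⟨E ∪ E', F ∪ F', fun p q hE hF => or_congr ?_ ?_⟩
    · exact hs.mono Finset.subset_union_left Finset.subset_union_left p q hE hF
    · exact ht.mono Finset.subset_union_right Finset.subset_union_right p q hE hF
  infClosed' := by
    classical
    rintro s ⟨E, F, hs⟩ t ⟨E', F', ht⟩
    refine ⟨E ∪ E', F ∪ F', fun p q hE hF => and_congr ?_ ?_⟩
    · exact hs.mono Finset.subset_union_left Finset.subset_union_left p q hE hF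
    · exact ht.mono Finset.subset_union_right Finset.subset_union_right p q hE hF
  compl_mem' := by
    rintro s ⟨E, F, hs⟩
    exact ⟨E, F, fun p q hE hF => not_congr (hs p q hE hF)⟩
  bot_mem' := ⟨∅, ∅, fun _ _ _ _ => Iff.rfl⟩

/-- All branches of the rule `a`. -/
def ruleCell (a : Rule n k) : finSupported code h n k :=
  ⟨{p | p.1.1 = a}, {a}, ∅, fun _ _ hE _ => hE a (Finset.mem_singleton_self a)⟩

/-- All branches with value `i` at `α`. -/
def valueCell (k : ℕ) (α : W) (i : Fin n) : finSupported code h n k :=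
  ⟨{p | p.1.2 α = i}, ∅, {α}, fun p q _ hF => by
    show p.1.2 α = i ↔ q.1.2 α = i
    rw [hF α (Finset.mem_singleton_self α)]⟩

variable {code h} in
theorem finSupported_ne_bot_iff {b : finSupported code h n k} : b ≠ ⊥ ↔ ∃ p, p ∈ b.1 := by
  rw [← Set.nonempty_def, Set.nonempty_iff_ne_empty]
  exact not_congr Subtype.ext_iff

theorem ruleCell_ne_bot [WellFoundedLT W] (hk : 0 < k) (a : Rule n k) :
    ruleCell code h a ≠ ⊥ := by
  obtain ⟨x, hx⟩ := branches_nonempty code h hk a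
  exact finSupported_ne_bot_iff.2 ⟨⟨(a, x), hx⟩, rfl⟩

variable {code h} in
theorem mem_sup_finset {R : Finset (finSupported code h n k)} {p : BranchSpace n k code h} :
    p ∈ (R.sup id).1 ↔ ∃ b ∈ R, p ∈ b.1 := by
  classical
  induction R using Finset.induction_on with
  | empty => simp only [Finset.sup_empty, Finset.notMem_empty, false_and, exists_false, iff_false]
             exact fun hp => hp
  | insert a s _ ih =>
    rw [Finset.sup_insert, Finset.exists_mem_insert, ← ih]
    exact Iff.rfl

variable {code h} in
theorem disjoint_finSupported_iff {b c : finSupported code h n k} :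
    Disjoint b c ↔ ∀ p, p ∈ b.1 → p ∉ c.1 := by
  rw [disjoint_iff, ← not_iff_not, ← ne_eq, finSupported_ne_bot_iff]
  push Not
  exact Iff.rfl

/-! ### Failure of reaping for the rule cells -/

variable {code h} in
/-- The countably many rule cells are not `(m, 2)`-reaped. -/
theorem ruleCells_not_reaped [WellFoundedLT W] (hcode : Function.Injective code)
    (hh : ∀ α β, β < α → ∃ j, h α j = β) {m : ℕ} (hk : 0 < k) (hkn : k ≤ n)
    (hm : m * (k - 1) < n) (R : Finset (finSupported code h n k)) :
    ¬ IsReapedBy m 2 (Set.range (ruleCell code h (n := n) (k := k))) R := by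
  classical
  rintro ⟨⟨hcard, htop, hdisj⟩, hreap⟩
  choose E F hEF using fun b : finSupported code h n k => b.2
  have hcover : ∀ p : BranchSpace n k code h, ∃ b ∈ R, p ∈ b.1 := by
    intro p
    rw [← mem_sup_finset, htop]
    exact Set.mem_univ p
  have hunique : ∀ p : BranchSpace n k code h, ∀ b ∈ R, ∀ c ∈ R, p ∈ b.1 → p ∈ c.1 → b = c := by
    intro p b hb c hc hpb hpc
    by_contra hne
    exact disjoint_finSupported_iff.1 (hdisj hb hc hne) p hpb hpc
  have hR : Nonempty R := by
    obtain ⟨x, hx⟩ := branches_nonempty code h hk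
      (⟨0, fun _ _ => ⟨Finset.univ, by simpa using hkn⟩⟩ : Rule n k)
    obtain ⟨b, hb, -⟩ := hcover ⟨(_, x), hx⟩
    exact ⟨⟨b, hb⟩⟩
  let E₀ := R.biUnion E
  let F₀ := R.biUnion F
  let P : (W → Fin n) → R → Prop := fun x b =>
    ∃ p : BranchSpace n k code h, p.1.1 ∉ E₀ ∧ (∀ β ∈ F₀, p.1.2 β = x β) ∧ p ∈ b.1.1
  -- `P x` sees only the values of `x` on `F₀`, so choosing by `epsilon` makes `g` depend on `F₀`
  -- alone, even where no pair satisfies `P`.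
  let g : (W → Fin n) → R := fun x => Classical.epsilon (P x)
  have hg : ∀ x y, (∀ β ∈ F₀, x β = y β) → g x = g y := by
    intro x y hxy
    have : P x = P y := by
      funext b
      refine propext (exists_congr fun p => and_congr_right fun _ => and_congr_left fun _ => ?_)
      exact forall₂_congr fun β hβ => by rw [hxy β hβ]
    show Classical.epsilon (P x) = Classical.epsilon (P y)
    rw [this]
  have hgmem : ∀ p : BranchSpace n k code h, p.1.1 ∉ E₀ → p ∈ (g p.1.2).1.1 := by
    intro p hp
    obtain ⟨b, hb, hpb⟩ := hcover p
    obtain ⟨q, hq, hqx, hqb⟩ := Classical.epsilon_spec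
      (p := P p.1.2) ⟨⟨b, hb⟩, p, hp, fun _ _ => rfl, hpb⟩
    refine (hEF (g p.1.2).1 q p (fun a ha => ?_) fun β hβ => ?_).1 hqb
    · have haE : a ∈ E₀ := Finset.mem_biUnion.2 ⟨_, (g p.1.2).2, ha⟩
      exact ⟨fun h1 => absurd (h1 ▸ haE) hq, fun h1 => absurd (h1 ▸ haE) hp⟩
    · exact hqx β (Finset.mem_biUnion.2 ⟨_, (g p.1.2).2, hβ⟩)
  -- A rule of high level avoids the finitely many rules that the partition can single out.
  have hlarge : ∀ᶠ l in atTop, ∀ a ∈ E₀, a.1 < l :=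
    (Finset.eventually_all E₀).2 fun a _ => eventually_gt_atTop a.1
  obtain ⟨l, hl, hlE⟩ := ((eventually_exists_monochromatic (C := R) hcode hh
    (by simpa [hcard] using hm) hkn F₀).and hlarge).exists
  obtain ⟨S, c, hS⟩ := hl g hg
  have ha : (⟨l, S⟩ : Rule n k) ∉ E₀ := fun hE => lt_irrefl _ (hlE _ hE)
  have hsub : {b | b ∈ R ∧ b ⊓ ruleCell code h ⟨l, S⟩ ≠ ⊥} ⊆ {c.1} := by
    rintro b ⟨hb, hbne⟩
    obtain ⟨p, hpb, hpa⟩ := finSupported_ne_bot_iff.1 hbne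
    have hpa' : p.1.1 = ⟨l, S⟩ := hpa
    refine hunique p b hb c.1 c.2 hpb ?_
    rw [← hS S (fun _ _ => rfl) p.1.2 (hpa' ▸ p.2)]
    exact hgmem p (hpa' ▸ ha)
  have h1 := Set.ncard_le_ncard hsub (Set.finite_singleton _)
  rw [Set.ncard_singleton] at h1
  have h2 := hreap _ ⟨⟨l, S⟩, rfl⟩
  omega

/-! ### Reaping of countable families by value cells -/

theorem valueCell_injective [WellFoundedLT W] (hk : 0 < k) (hkn : k ≤ n) (α : W) :
    Function.Injective (valueCell code h k α (n := n)) := by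
  intro i j hij
  -- The rule that allows everything realises each value at `α`, so no cell is empty.
  let a : Rule n k := ⟨0, fun _ _ => ⟨Finset.univ, by simpa using hkn⟩⟩
  obtain ⟨x, hx⟩ := branches_nonempty code h hk a
  obtain ⟨y, hy, -, hyi⟩ := exists_branch_update hk hx (α := α) (i := i) (Finset.mem_univ i)
  have h1 : (⟨(a, y), hy⟩ : BranchSpace n k code h) ∈ (valueCell code h k α i).1 := hyi
  rw [hij] at h1
  exact hyi.symm.trans h1

theorem valueCells_isPartition [WellFoundedLT W] (hk : 0 < k) (hkn : k ≤ n) (α : W)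
    [DecidableEq (finSupported code h n k)] :
    IsPartition n (Finset.univ.image (valueCell code h k α (n := n))) := by
  refine ⟨?_, ?_, ?_⟩
  · rw [Finset.card_image_of_injective _ (valueCell_injective code h hk hkn α)]
    simp
  · refine Subtype.ext (Set.eq_univ_of_forall fun p => ?_)
    exact mem_sup_finset.2 ⟨_, Finset.mem_image_of_mem _ (Finset.mem_univ (p.1.2 α)), rfl⟩
  · rintro b hb c hc hne
    obtain ⟨i, -, rfl⟩ := Finset.mem_image.1 (Finset.mem_coe.1 hb)
    obtain ⟨j, -, rfl⟩ := Finset.mem_image.1 (Finset.mem_coe.1 hc)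
    refine disjoint_finSupported_iff.2 fun p hpi hpj => hne ?_
    have hpi' : p.1.2 α = i := hpi
    have hpj' : p.1.2 α = j := hpj
    rw [← hpi', ← hpj']

/-- Countable sets of nonzero elements are `(n, k)`-reaped. -/
theorem exists_reaping_of_countable [WellFoundedLT W]
    (hbdd : ∀ s : Set W, s.Countable → ∃ α, ∀ β ∈ s, β < α) (hk : 0 < k) (hkn : k ≤ n)
    (A : Set (finSupported code h n k)) (hA : A.Countable) (hbot : ⊥ ∉ A) :
    ∃ R, IsReapedBy n k A R := by
  classical
  choose E F hEF using fun b : finSupported code h n k => b.2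
  obtain ⟨α, hα⟩ := hbdd (⋃ b ∈ A, (F b : Set W)) (hA.biUnion fun b _ => (F b).countable_toSet)
  refine ⟨_, valueCells_isPartition code h hk hkn α, fun b hb => ?_⟩
  obtain ⟨p, hp⟩ := finSupported_ne_bot_iff.1 (ne_of_mem_of_not_mem hb hbot)
  have hsub : ((allowed code h p.1.1 p.1.2 α).image (valueCell code h k α) : Set _) ⊆
      {c | c ∈ Finset.univ.image (valueCell code h k α (n := n)) ∧ c ⊓ b ≠ ⊥} := by
    intro c hc
    obtain ⟨i, hi, rfl⟩ := Finset.mem_image.1 (Finset.mem_coe.1 hc)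
    refine ⟨Finset.mem_image_of_mem _ (Finset.mem_univ i), ?_⟩
    obtain ⟨y, hy, hyx, hyi⟩ := exists_branch_update hk p.2 hi
    refine finSupported_ne_bot_iff.2 ⟨⟨(p.1.1, y), hy⟩, hyi, ?_⟩
    -- The support of `b` lies below `α`, so changing the value at `α` keeps the branch in `b`.
    refine (hEF b p ⟨(p.1.1, y), hy⟩ (fun a _ => Iff.rfl) fun β hβ => ?_).1 hp
    exact (hyx β (hα β (Set.mem_biUnion hb hβ))).symm
  refine le_trans ?_ (Set.ncard_le_ncard hsub
    ((Finset.finite_toSet _).subset fun c hc => hc.1))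
  rw [Set.ncard_coe_finset, Finset.card_image_of_injective _ (valueCell_injective code h hk hkn α)]
  exact (p.1.1.2 _ _).2

end Construction

/-- If every colouring of `n` points with `m` colours is constant on some set of `k` points, then
`r_{n,k} ≤ r_{m,2}` fails for some Boolean algebra. -/
theorem exists_not_reapingNumber_le {n k m : ℕ} (hk : 2 ≤ k) (hkn : k ≤ n)
    (hm : m * (k - 1) < n) :
    ∃ (B : Type) (_ : BooleanAlgebra B), ¬ reapingNumber B n k ≤ reapingNumber B m 2 := by
  have : NeZero n := ⟨by omega⟩
  obtain ⟨W, _, _, code, h, hcode, hh, hbdd⟩ := exists_coded_wellOrder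
  refine ⟨finSupported code h n k, inferInstance, fun hle => ?_⟩
  have hsmall : reapingNumber (finSupported code h n k) m 2 ≤ Cardinal.aleph0 := by
    have hcount := Cardinal.le_aleph0_iff_set_countable.2
      (Set.countable_range (ruleCell code h (n := n) (k := k)))
    refine le_trans (csInf_le' ?_) hcount
    refine ⟨Set.range (ruleCell code h), ?_, ?_, rfl⟩
    · rintro ⟨a, ha⟩
      exact ruleCell_ne_bot code h (by omega) a ha
    · rintro ⟨R, hR⟩
      exact ruleCells_not_reaped hcode hh (by omega) hkn hm R hR
  obtain ⟨A₀, hbot₀, hA₀⟩ := exists_not_reaped (finSupported code h n k) (hk.trans hkn) hk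
  obtain ⟨A, hbot, hA, hcard⟩ := csInf_mem
    (s := {κ | ∃ A : Set (finSupported code h n k),
      ⊥ ∉ A ∧ (¬ ∃ R : Finset _, IsReapedBy n k A R) ∧ Cardinal.mk A = κ})
    ⟨_, A₀, hbot₀, hA₀, rfl⟩
  refine hA (exists_reaping_of_countable code h hbdd (by omega) hkn A ?_ hbot)
  rw [← Cardinal.le_aleph0_iff_set_countable, hcard]
  exact hle.trans hsmall

end BooleanReaping

theorem mainTheorem11 :
    (∃ (B₁ : Type) (_ : BooleanAlgebra B₁),
      ¬ BooleanReaping.reapingNumber B₁ 9 5 ≤ BooleanReaping.reapingNumber B₁ 2 2) ∧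
    (∃ (B₂ : Type) (_ : BooleanAlgebra B₂),
      ¬ BooleanReaping.reapingNumber B₂ 10 4 ≤ BooleanReaping.reapingNumber B₂ 3 2) ∧
    (∃ (B₃ : Type) (_ : BooleanAlgebra B₃),
      ¬ BooleanReaping.reapingNumber B₃ 9 3 ≤ BooleanReaping.reapingNumber B₃ 4 2) := by
  exact ⟨BooleanReaping.exists_not_reapingNumber_le (by norm_num) (by norm_num) (by norm_num),
    BooleanReaping.exists_not_reapingNumber_le (by norm_num) (by norm_num) (by norm_num),
    BooleanReaping.exists_not_reapingNumber_le (by norm_num) (by norm_num) (by norm_num)⟩
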